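/- Let $B$ be a $C^*$-algebra and let $A\subseteq B$ be a maximal abelian $C^*$-subalgebra (masa) such that the inclusion is regular, i.e. the set of normalisers $N(A,B)=\{n\in B: n^*An\subseteq A,\ nAn^*\subseteq A\}$ spans a dense subspace of $B$. Then: 1. The inclusion $A\subseteq B$ is aperiodic: for every $\varepsilon>0$, every non-zero hereditary $C^*$-subalgebra $D\subseteq A$ and every $x\in B/A$ there is $a\in D$ with $a\geq 0$, $\|a\|=1$ and $\|axa\|<\varepsilon$ in the quotient norm of the Banach $A$-bimodule $B/A$. 2. There is at most one local expectation $E\colon B\to M_{\mathrm{loc}}(A)$. Here $M_{\mathrm{loc}}(A)=\varinjlim_I M(I)$ is the local multiplier algebra, the $C^*$-algebraic direct limit of the multiplier algebras of the essential closed ideals $I$ of $A$ along the restriction maps, and a local expectation is a completely positive contractive linear map $E$ whose restriction to $A$ is the canonical embedding $A\subseteq M_{\mathrm{loc}}(A)$. 3. If $E$ is a local expectation, then $E(W)\subseteq M(W\cap A)$ for every slice $W\subseteq B$, that is, for every closed linear subspace $W\subseteq N(A,B)$ with $AW+WA\subseteq W$ and $W^*W+WW^*\subseteq A$. Here $W\cap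 A$ is a closed ideal of $A$ and, for a closed ideal $J$ of $A$ with annihilator $J^\perp$, $M(J)$ is regarded as a subalgebra of $M_{\mathrm{loc}}(A)$ by extending multipliers of $J$ by zero to the essential ideal $J\oplus J^\perp$. -/

import Mathlib

noncomputable section

open scoped MultiplierAlgebra
open Filter Topology

/-- A closed two-sided ideal of a C⋆-algebra. -/
structure ClosedIdeal (A : Type*) [NonUnitalCStarAlgebra A] extends Submodule ℂ A where
  isClosed' : IsClosed carrier
  mul_mem_left' : ∀ (a : A) {x : A}, x ∈ carrier → a * x ∈ carrier
  mul_mem_right' : ∀ (a : A) {x : A}, x ∈ carrier → x * a ∈ carrier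

namespace ClosedIdeal

variable {A : Type*} [NonUnitalCStarAlgebra A]

instance : SetLike (ClosedIdeal A) A where
  coe I := I.carrier
  coe_injective I J h := by
    obtain ⟨I, _, _, _⟩ := I
    obtain ⟨J, _, _, _⟩ := J
    congr
    exact SetLike.coe_injective h

instance : PartialOrder (ClosedIdeal A) := .ofSetLike (ClosedIdeal A) A

theorem mul_mem_left (I : ClosedIdeal A) (a : A) {x : A} (hx : x ∈ I) : a * x ∈ I :=
  I.mul_mem_left' a hx

theorem mul_mem_right (I : ClosedIdeal A) (a : A) {x : A} (hx : x ∈ I) : x * a ∈ I :=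
  I.mul_mem_right' a hx

instance isClosed (I : ClosedIdeal A) : IsClosed (I : Set A) := I.isClosed'

instance : NonUnitalSubringClass (ClosedIdeal A) A where
  add_mem {I} _ _ ha hb := I.add_mem ha hb
  zero_mem I := I.zero_mem
  neg_mem {I} _ ha := I.toSubmodule.neg_mem ha
  mul_mem {I} a _ _ hb := I.mul_mem_left a hb

instance : SMulMemClass (ClosedIdeal A) ℂ A where
  smul_mem {I} c _ ha := I.smul_mem c ha

/-- Closed two-sided ideals of C⋆-algebras are self-adjoint. -/
theorem star_mem' (I : ClosedIdeal A) {a : A} (ha : a ∈ I) : star a ∈ I := by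
  let N : NonUnitalStarSubalgebra ℂ A :=
    { carrier := {x | x ∈ I ∧ star x ∈ I}
      add_mem' := fun {x y} hx hy => ⟨add_mem hx.1 hy.1, by
        rw [star_add]; exact add_mem hx.2 hy.2⟩
      zero_mem' := ⟨zero_mem I, by rw [star_zero]; exact zero_mem I⟩
      mul_mem' := fun {x y} hx hy => ⟨mul_mem hx.1 hy.1, by
        rw [star_mul]; exact mul_mem hy.2 hx.2⟩
      smul_mem' := fun c x hx => ⟨SMulMemClass.smul_mem c hx.1, by
        rw [star_smul]; exact SMulMemClass.smul_mem _ hx.2⟩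
      star_mem' := fun {x} hx => ⟨hx.2, by rw [star_star]; exact hx.1⟩ }
  have : IsClosed (N : Set A) :=
    I.isClosed.inter (I.isClosed.preimage continuous_star)
  let _ : PartialOrder N := CStarAlgebra.spectralOrder N
  have : StarOrderedRing N := CStarAlgebra.spectralOrderedRing N
  have hl := CStarAlgebra.increasingApproximateUnit N
  let l := CStarAlgebra.approximateUnit N
  have : l.NeBot := hl.neBot
  have hp : a * star a ∈ N :=
    ⟨I.mul_mem_right _ ha, by rw [star_mul, star_star]; exact I.mul_mem_right _ ha⟩
  set p : N := ⟨a * star a, hp⟩ with hpdef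
  have hR : Tendsto (fun e : N => p - p * e) l (𝓝 0) := by
    simpa using (tendsto_const_nhds (x := p)).sub (hl.tendsto_mul_left p)
  have hbd : ∀ᶠ e : N in l, ‖star a - star a * (e : A)‖ ^ 2 ≤ 2 * ‖p - p * e‖ := by
    filter_upwards [hl.eventually_norm, hl.eventually_star_eq] with e he hes
    have h1 : ‖star a - star a * (e : A)‖ ^ 2
        = ‖star (star a - star a * (e : A)) * (star a - star a * (e : A))‖ := by
      rw [CStarRing.norm_star_mul_self, sq]
    have hes' : star (e : A) = e := congrArg Subtype.val hes
    have h2 : star (star a - star a * (e : A)) * (star a - star a * (e : A))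
        = ((p - p * e - e * (p - p * e) : N) : A) := by
      simp only [star_sub, star_mul, star_star, hes', hpdef]
      push_cast
      noncomm_ring
    rw [h1, h2]
    calc ‖((p - p * e - e * (p - p * e) : N) : A)‖ = ‖p - p * e - e * (p - p * e)‖ := rfl
      _ ≤ ‖p - p * e‖ + ‖e * (p - p * e)‖ := norm_sub_le _ _
      _ ≤ ‖p - p * e‖ + 1 * ‖p - p * e‖ := by
          gcongr
          exact (norm_mul_le _ _).trans (by gcongr)
      _ = 2 * ‖p - p * e‖ := by ring
  have h0 : Tendsto (fun e : N => ‖star a - star a * (e : A)‖ ^ 2) l (𝓝 0) :=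
    squeeze_zero' (.of_forall fun _ => by positivity) hbd (by simpa using hR.norm.const_mul 2)
  have h1 : Tendsto (fun e : N => ‖star a - star a * (e : A)‖) l (𝓝 0) := by
    simpa using h0.sqrt
  have h2 : Tendsto (fun e : N => star a * (e : A)) l (𝓝 (star a)) := by
    rw [tendsto_iff_norm_sub_tendsto_zero]
    simpa [norm_sub_rev] using h1
  exact I.isClosed.mem_of_tendsto h2 (.of_forall fun e => I.mul_mem_left _ e.2.1)

instance : StarMemClass (ClosedIdeal A) A where
  star_mem {I} _ ha := I.star_mem' ha


section Multiplier

variable {I J K : ClosedIdeal A}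

theorem fst_mul (m : 𝓜(ℂ, I)) (x y : I) : m.fst (x * y) = m.fst x * y := by
  have h : ∀ z : I, z * (m.fst (x * y) - m.fst x * y) = 0 := fun z => by
    rw [mul_sub, ← m.central, ← mul_assoc, ← mul_assoc, ← m.central, sub_self]
  exact sub_eq_zero.1 (CStarRing.star_mul_self_eq_zero_iff _ |>.1 (h _))

theorem snd_mul (m : 𝓜(ℂ, I)) (x y : I) : m.snd (x * y) = x * m.snd y := by
  have h : ∀ z : I, (m.snd (x * y) - x * m.snd y) * z = 0 := fun z => by
    rw [sub_mul, m.central, mul_assoc, mul_assoc, m.central, sub_self]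
  exact sub_eq_zero.1 (CStarRing.mul_star_self_eq_zero_iff _ |>.1 (h _))

/-- The inclusion of a smaller ideal into a larger one. -/
def incl (h : J ≤ I) (x : J) : I := ⟨x, h x.2⟩

/-- A multiplier of `I` maps every closed ideal `J ⊆ I` into itself. -/
theorem fst_mem (h : J ≤ I) (m : 𝓜(ℂ, I)) (x : J) : (m.fst (incl h x) : A) ∈ J := by
  let _ : PartialOrder J := CStarAlgebra.spectralOrder J
  have : StarOrderedRing J := CStarAlgebra.spectralOrderedRing J
  have hl := CStarAlgebra.increasingApproximateUnit J
  have := hl.neBot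
  have hc : Continuous fun y : J => (m.fst (incl h y) : A) :=
    continuous_subtype_val.comp
      (m.fst.continuous.comp (continuous_subtype_val.subtype_mk _))
  refine J.isClosed.mem_of_tendsto ((hc.tendsto x).comp (hl.tendsto_mul_left x))
    (.of_forall fun e => ?_)
  have : m.fst (incl h (x * e)) = m.fst (incl h x) * incl h e := fst_mul m (incl h x) (incl h e)
  simp only [Function.comp, this]
  exact J.mul_mem_left _ e.2

theorem snd_mem (h : J ≤ I) (m : 𝓜(ℂ, I)) (x : J) : (m.snd (incl h x) : A) ∈ J := by
  have := J.star_mem' (fst_mem h (star m) (star x))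
  rw [DoubleCentralizer.star_fst] at this
  have h2 : star (incl h (star x)) = incl h x := Subtype.ext (star_star (x : A))
  rw [h2] at this
  simpa using this

/-- Restriction of multipliers `M(I) → M(J)` for closed ideals `J ⊆ I`. -/
def restrict (h : J ≤ I) : 𝓜(ℂ, I) →⋆ₐ[ℂ] 𝓜(ℂ, J) where
  toFun m :=
    { fst :=
        { toFun := fun x => ⟨m.fst (incl h x), fst_mem h m x⟩
          map_add' := fun x y => Subtype.ext <| congrArg (Subtype.val (p := (· ∈ I)))
            (map_add m.fst (incl h x) (incl h y))
          map_smul' := fun c x => Subtype.ext <| congrArg (Subtype.val (p := (· ∈ I)))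
            (map_smul m.fst c (incl h x))
          cont := (continuous_subtype_val.comp
            (m.fst.continuous.comp (continuous_subtype_val.subtype_mk _))).subtype_mk _ }
      snd :=
        { toFun := fun x => ⟨m.snd (incl h x), snd_mem h m x⟩
          map_add' := fun x y => Subtype.ext <| congrArg (Subtype.val (p := (· ∈ I)))
            (map_add m.snd (incl h x) (incl h y))
          map_smul' := fun c x => Subtype.ext <| congrArg (Subtype.val (p := (· ∈ I)))
            (map_smul m.snd c (incl h x))
          cont := (continuous_subtype_val.comp
            (m.snd.continuous.comp (continuous_subtype_val.subtype_mk _))).subtype_mk _ }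
      central := fun x y => Subtype.ext <| congrArg (Subtype.val (p := (· ∈ I)))
        (m.central (incl h x) (incl h y)) }
  map_one' := rfl
  map_mul' _ _ := rfl
  map_zero' := rfl
  map_add' _ _ := rfl
  commutes' _ := rfl
  map_star' _ := rfl

end Multiplier

/-- The annihilator `I^⊥ = {a ∈ A : a x = 0 for all x ∈ I}`. -/
def perp (I : ClosedIdeal A) : ClosedIdeal A where
  carrier := {a | ∀ x ∈ I, a * x = 0}
  add_mem' ha hb x hx := by rw [add_mul, ha x hx, hb x hx, add_zero]
  zero_mem' x _ := zero_mul x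
  smul_mem' c a ha x hx := by rw [smul_mul_assoc, ha x hx, smul_zero]
  isClosed' := by
    simp only [Set.ofPred_forall]
    exact isClosed_iInter fun x => isClosed_iInter fun _ =>
      isClosed_eq (continuous_mul_const x) continuous_const
  mul_mem_left' b a ha x hx := by rw [mul_assoc, ha x hx, mul_zero]
  mul_mem_right' b a ha x hx := by rw [mul_assoc, ha _ (I.mul_mem_left b hx)]

/-- A closed ideal is essential if its annihilator is zero. -/
def IsEssential (I : ClosedIdeal A) : Prop := ∀ a ∈ I.perp, a = 0

theorem perp_mul {I : ClosedIdeal A} {a x : A} (ha : a ∈ I.perp) (hx : x ∈ I) : a * x = 0 :=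
  ha x hx

theorem mul_perp {I : ClosedIdeal A} {a x : A} (ha : a ∈ I.perp) (hx : x ∈ I) : x * a = 0 := by
  have := perp_mul (I.perp.star_mem' ha) (I.star_mem' hx)
  rw [← star_mul] at this
  exact star_eq_zero.1 this

theorem norm_le_of_perp {I : ClosedIdeal A} {a x : A} (ha : a ∈ I.perp) (hx : x ∈ I) :
    ‖x‖ ≤ ‖x + a‖ := by
  have h : star x * (x + a) = star x * x := by
    rw [mul_add, mul_perp ha (I.star_mem' hx), add_zero]
  have h2 : ‖x‖ * ‖x‖ ≤ ‖x‖ * ‖x + a‖ := by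
    rw [← CStarRing.norm_star_mul_self, ← h]
    simpa using norm_mul_le (star x) (x + a)
  rcases (norm_nonneg x).eq_or_lt with h0 | h0
  · rw [← h0]; positivity
  · exact le_of_mul_le_mul_left h2 h0

theorem restrict_injective {I J : ClosedIdeal A} (h : J ≤ I) (hJ : J.IsEssential) :
    Function.Injective (restrict h) := by
  rw [injective_iff_map_eq_zero]
  intro m hm
  have hf : ∀ x : J, m.fst (incl h x) = 0 := fun x => by
    have := congrArg (fun n : 𝓜(ℂ, J) => ((n.fst x : J) : A)) hm
    exact Subtype.ext this
  have : m.fst = 0 := by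
    ext x
    refine hJ _ fun y hy => ?_
    have h1 := fst_mul m x (incl h ⟨y, hy⟩)
    have h2 : x * incl h ⟨y, hy⟩ = incl h ⟨x * y, J.mul_mem_left _ hy⟩ := rfl
    rw [h2, hf] at h1
    exact (congrArg Subtype.val h1).symm
  rw [← norm_eq_zero, ← DoubleCentralizer.norm_fst, this, norm_zero]

/-- The sum `I ⊕ I^⊥`, which is a closed ideal. -/
def sumPerp (I : ClosedIdeal A) : ClosedIdeal A where
  toSubmodule := I.toSubmodule ⊔ I.perp.toSubmodule
  isClosed' := by
    rw [← isSeqClosed_iff_isClosed]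
    intro u b hu hb
    have hdec : ∀ n, ∃ x ∈ I, ∃ y ∈ I.perp, x + y = u n := fun n => Submodule.mem_sup.1 (hu n)
    choose x hx y hy hxy using hdec
    have hcau : CauchySeq x := by
      have hcu := hb.cauchySeq
      rw [Metric.cauchySeq_iff] at hcu ⊢
      intro ε hε
      obtain ⟨N, hN⟩ := hcu ε hε
      refine ⟨N, fun m hm n hn => lt_of_le_of_lt ?_ (hN m hm n hn)⟩
      rw [dist_eq_norm, dist_eq_norm, ← hxy, ← hxy, add_sub_add_comm]
      exact norm_le_of_perp (sub_mem (hy m) (hy n)) (sub_mem (hx m) (hx n))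
    obtain ⟨x₀, hx₀⟩ := cauchySeq_tendsto_of_complete hcau
    have hx₀' : x₀ ∈ I := I.isClosed.mem_of_tendsto hx₀ (.of_forall hx)
    have hy₀ : b - x₀ ∈ I.perp := I.perp.isClosed.mem_of_tendsto (hb.sub hx₀)
      (.of_forall fun n => by rw [← hxy]; simpa using hy n)
    exact Submodule.mem_sup.2 ⟨x₀, hx₀', b - x₀, hy₀, by abel⟩
  mul_mem_left' a z hz := by
    obtain ⟨x, hx, y, hy, rfl⟩ := Submodule.mem_sup.1 hz
    rw [mul_add]
    exact Submodule.mem_sup.2 ⟨_, I.mul_mem_left a hx, _, I.perp.mul_mem_left a hy, rfl⟩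
  mul_mem_right' a z hz := by
    obtain ⟨x, hx, y, hy, rfl⟩ := Submodule.mem_sup.1 hz
    rw [add_mul]
    exact Submodule.mem_sup.2 ⟨_, I.mul_mem_right a hx, _, I.perp.mul_mem_right a hy, rfl⟩

theorem mem_sumPerp {I : ClosedIdeal A} {z : A} :
    z ∈ I.sumPerp ↔ ∃ x ∈ I, ∃ y ∈ I.perp, x + y = z := Submodule.mem_sup

theorem le_sumPerp (I : ClosedIdeal A) : I ≤ I.sumPerp := fun x hx =>
  mem_sumPerp.2 ⟨x, hx, 0, zero_mem _, add_zero x⟩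

theorem perp_le_sumPerp (I : ClosedIdeal A) : I.perp ≤ I.sumPerp := fun x hx =>
  mem_sumPerp.2 ⟨0, zero_mem _, x, hx, zero_add x⟩

theorem sumPerp_isEssential (I : ClosedIdeal A) : I.sumPerp.IsEssential := fun a ha => by
  have h1 : a ∈ I.perp := fun x hx => ha x (I.le_sumPerp hx)
  exact (CStarRing.mul_star_self_eq_zero_iff a).1
    (ha _ (I.perp_le_sumPerp (I.perp.star_mem' h1)))

theorem eq_of_add_perp {I : ClosedIdeal A} {x x' y y' : A} (hx : x ∈ I) (hx' : x' ∈ I)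
    (hy : y ∈ I.perp) (hy' : y' ∈ I.perp) (h : x + y = x' + y') : x = x' := by
  have := norm_le_of_perp (sub_mem hy hy') (sub_mem hx hx')
  rw [← add_sub_add_comm, h, sub_self, norm_zero] at this
  exact sub_eq_zero.1 (norm_le_zero_iff.1 this)

/-- The projection `I ⊕ I^⊥ → I`. -/
def proj (I : ClosedIdeal A) (z : I.sumPerp) : I :=
  ⟨(mem_sumPerp.1 z.2).choose, (mem_sumPerp.1 z.2).choose_spec.1⟩

theorem sub_proj_mem (I : ClosedIdeal A) (z : I.sumPerp) : (z : A) - I.proj z ∈ I.perp := by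
  obtain ⟨y, hy, h⟩ := (mem_sumPerp.1 z.2).choose_spec.2
  have h2 : (z : A) - I.proj z = y := sub_eq_of_eq_add' h.symm
  rw [h2]
  exact hy

theorem proj_eq (I : ClosedIdeal A) {z : I.sumPerp} {x : I} (h : (z : A) - x ∈ I.perp) :
    I.proj z = x :=
  Subtype.ext <| eq_of_add_perp (I.proj z).2 x.2 (I.sub_proj_mem z) h (by abel)

/-- The projection `I ⊕ I^⊥ → I` as a continuous linear map. -/
def projL (I : ClosedIdeal A) : I.sumPerp →L[ℂ] I :=
  LinearMap.mkContinuous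
    { toFun := I.proj
      map_add' := fun z w => I.proj_eq <| by
        have := add_mem (I.sub_proj_mem z) (I.sub_proj_mem w)
        rw [← add_sub_add_comm] at this
        exact this
      map_smul' := fun c z => I.proj_eq <| by
        have := SMulMemClass.smul_mem c (I.sub_proj_mem z)
        rw [smul_sub] at this
        exact this } 1 fun z => by
      have := norm_le_of_perp (I.sub_proj_mem z) (I.proj z).2
      rw [add_sub_cancel] at this
      rw [one_mul]
      exact this

/-- The inclusion `I → I ⊕ I^⊥` as a continuous linear map. -/
def inclSumPerpL (I : ClosedIdeal A) : I →L[ℂ] I.sumPerp where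
  toFun := incl I.le_sumPerp
  map_add' _ _ := rfl
  map_smul' _ _ := rfl
  cont := continuous_subtype_val.subtype_mk _

/-- Extension of multipliers by zero, `M(I) → M(I ⊕ I^⊥)`, `m ↦ (x + y ↦ m x)`. -/
def extendByZero (I : ClosedIdeal A) (m : 𝓜(ℂ, I)) : 𝓜(ℂ, I.sumPerp) where
  fst := I.inclSumPerpL ∘L m.fst ∘L I.projL
  snd := I.inclSumPerpL ∘L m.snd ∘L I.projL
  central z w := by
    apply Subtype.ext
    change (m.snd (I.proj z) : A) * w = z * (m.fst (I.proj w) : A)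
    have h1 : (m.snd (I.proj z) : A) * (w - I.proj w) = 0 :=
      mul_perp (I.sub_proj_mem w) (m.snd (I.proj z)).2
    have h2 : ((z : A) - I.proj z) * (m.fst (I.proj w) : A) = 0 :=
      perp_mul (I.sub_proj_mem z) (m.fst (I.proj w)).2
    rw [mul_sub, sub_eq_zero] at h1
    rw [sub_mul, sub_eq_zero] at h2
    rw [h1, h2]
    exact congrArg Subtype.val (m.central (I.proj z) (I.proj w))

/-- The whole algebra as a closed ideal. -/
def whole (A : Type*) [NonUnitalCStarAlgebra A] : ClosedIdeal A where
  toSubmodule := ⊤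
  isClosed' := isClosed_univ
  mul_mem_left' _ _ _ := trivial
  mul_mem_right' _ _ _ := trivial

theorem mem_whole (a : A) : a ∈ whole A := trivial

theorem whole_isEssential : (whole A).IsEssential := fun a ha =>
  (CStarRing.mul_star_self_eq_zero_iff a).1 (ha _ (mem_whole _))

/-- The intersection of two closed ideals. -/
def inter (I J : ClosedIdeal A) : ClosedIdeal A where
  toSubmodule := I.toSubmodule ⊓ J.toSubmodule
  isClosed' := I.isClosed.inter J.isClosed
  mul_mem_left' a _ hx := ⟨I.mul_mem_left a hx.1, J.mul_mem_left a hx.2⟩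
  mul_mem_right' a _ hx := ⟨I.mul_mem_right a hx.1, J.mul_mem_right a hx.2⟩

theorem IsEssential.inter {I J : ClosedIdeal A} (hI : I.IsEssential) (hJ : J.IsEssential) :
    (I.inter J).IsEssential := fun a ha => by
  refine hI a fun x hx => hJ _ fun y hy => ?_
  rw [mul_assoc]
  exact ha _ ⟨I.mul_mem_right y hx, J.mul_mem_left x hy⟩

end ClosedIdeal

/-- The essential closed ideals of `A`, ordered by reverse inclusion: `I ≤ J` means `J ⊆ I`. -/
structure EssentialIdeal (A : Type*) [NonUnitalCStarAlgebra A] where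
  ideal : ClosedIdeal A
  essential : ideal.IsEssential

namespace EssentialIdeal

variable {A : Type*} [NonUnitalCStarAlgebra A]

instance : Preorder (EssentialIdeal A) where
  le I J := J.1 ≤ I.1
  le_refl I := le_refl I.1
  le_trans _ _ _ h h' := le_trans h' h

instance : Nonempty (EssentialIdeal A) := ⟨⟨ClosedIdeal.whole A, ClosedIdeal.whole_isEssential⟩⟩

instance : IsDirectedOrder (EssentialIdeal A) where
  directed I J := ⟨⟨I.1.inter J.1, I.2.inter J.2⟩, fun _ h => h.1, fun _ h => h.2⟩

/-- The multiplier algebra of an essential ideal. -/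
abbrev Mult (I : EssentialIdeal A) : Type _ := 𝓜(ℂ, I.ideal)

/-- The restriction maps `M(I) → M(J)` for essential ideals `J ⊆ I`. -/
abbrev res (I J : EssentialIdeal A) (h : I ≤ J) : I.Mult →⋆ₐ[ℂ] J.Mult :=
  ClosedIdeal.restrict h

instance : DirectedSystem (Mult (A := A)) (res · · ·) where
  map_self _ _ := rfl
  map_map _ _ _ _ _ _ := rfl

theorem norm_res {I J : EssentialIdeal A} (h : I ≤ J) (m : I.Mult) : ‖res I J h m‖ = ‖m‖ :=
  NonUnitalStarAlgHom.norm_map (res I J h) (ClosedIdeal.restrict_injective h J.2) m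

end EssentialIdeal

/-- The algebraic direct limit of the multiplier algebras `M(I)` over the essential ideals `I`. -/
def AlgLocalMultiplier (A : Type*) [NonUnitalCStarAlgebra A] : Type _ :=
  DirectLimit (EssentialIdeal.Mult (A := A)) EssentialIdeal.res

namespace AlgLocalMultiplier

variable {A : Type*} [NonUnitalCStarAlgebra A]

instance : Ring (AlgLocalMultiplier A) :=
  inferInstanceAs (Ring (DirectLimit (EssentialIdeal.Mult (A := A)) EssentialIdeal.res))

instance : StarMul (AlgLocalMultiplier A) :=
  inferInstanceAs (StarMul (DirectLimit (EssentialIdeal.Mult (A := A)) EssentialIdeal.res))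

/-- The class in the direct limit of a multiplier of an essential ideal. -/
def of (I : EssentialIdeal A) (m : I.Mult) : AlgLocalMultiplier A := Quotient.mk _ ⟨I, m⟩

theorem exists_of (x : AlgLocalMultiplier A) : ∃ I m, x = of I m := DirectLimit.exists_eq_mk _ x

theorem exists_of₂ (x y : AlgLocalMultiplier A) : ∃ I m n, x = of I m ∧ y = of I n :=
  DirectLimit.exists_eq_mk₂ _ x y

theorem of_add (I : EssentialIdeal A) (m n : I.Mult) : of I m + of I n = of I (m + n) :=
  DirectLimit.add_def I m n

theorem of_mul (I : EssentialIdeal A) (m n : I.Mult) : of I m * of I n = of I (m * n) :=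
  DirectLimit.mul_def I m n

theorem of_neg (I : EssentialIdeal A) (m : I.Mult) : -of I m = of I (-m) := rfl

theorem of_zero (I : EssentialIdeal A) : of I 0 = 0 := (DirectLimit.zero_def I).symm

theorem of_star (I : EssentialIdeal A) (m : I.Mult) : star (of I m) = of I (star m) := rfl

instance : StarRing (AlgLocalMultiplier A) where
  star_add x y := by
    obtain ⟨I, m, n, rfl, rfl⟩ := exists_of₂ x y
    simp only [of_add, of_star, star_add]

instance : SMul ℂ (AlgLocalMultiplier A) where
  smul c := DirectLimit.map _ _ (fun _ m => c • m) fun I J h m => map_smul (EssentialIdeal.res I J h) c m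

theorem of_smul (I : EssentialIdeal A) (c : ℂ) (m : I.Mult) : c • of I m = of I (c • m) := rfl

instance : Module ℂ (AlgLocalMultiplier A) where
  one_smul x := by
    obtain ⟨I, m, rfl⟩ := exists_of x
    rw [of_smul, one_smul]
  mul_smul a b x := by
    obtain ⟨I, m, rfl⟩ := exists_of x
    simp only [of_smul, mul_smul]
  smul_zero a := by
    rw [← of_zero (Classical.arbitrary _), of_smul, smul_zero]
  smul_add a x y := by
    obtain ⟨I, m, n, rfl, rfl⟩ := exists_of₂ x y
    simp only [of_smul, of_add, smul_add]
  add_smul a b x := by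
    obtain ⟨I, m, rfl⟩ := exists_of x
    simp only [of_smul, of_add, add_smul]
  zero_smul x := by
    obtain ⟨I, m, rfl⟩ := exists_of x
    rw [of_smul, zero_smul, of_zero]

instance : Algebra ℂ (AlgLocalMultiplier A) :=
  Algebra.ofModule
    (fun c x y => by
      obtain ⟨I, m, n, rfl, rfl⟩ := exists_of₂ x y
      simp only [of_smul, of_mul, smul_mul_assoc])
    (fun c x y => by
      obtain ⟨I, m, n, rfl, rfl⟩ := exists_of₂ x y
      simp only [of_smul, of_mul, mul_smul_comm])

instance : StarModule ℂ (AlgLocalMultiplier A) where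
  star_smul c x := by
    obtain ⟨I, m, rfl⟩ := exists_of x
    simp only [of_smul, of_star, star_smul]

/-- The norm of the direct limit: the restriction maps are isometric. -/
instance : Norm (AlgLocalMultiplier A) where
  norm := DirectLimit.lift _ (fun _ m => ‖m‖) fun _ _ h m => (EssentialIdeal.norm_res h m).symm

theorem norm_of (I : EssentialIdeal A) (m : I.Mult) : ‖of I m‖ = ‖m‖ := rfl

instance : NormedRing (AlgLocalMultiplier A) where
  __ := AddGroupNorm.toNormedAddCommGroup (E := AlgLocalMultiplier A)
    { toFun := norm
      map_zero' := by rw [← of_zero (Classical.arbitrary _), norm_of, norm_zero]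
      add_le' := fun x y => by
        obtain ⟨I, m, n, rfl, rfl⟩ := exists_of₂ x y
        simpa only [of_add, norm_of] using norm_add_le m n
      neg' := fun x => by
        obtain ⟨I, m, rfl⟩ := exists_of x
        rw [of_neg, norm_of, norm_of, norm_neg]
      eq_zero_of_map_eq_zero' := fun x hx => by
        obtain ⟨I, m, rfl⟩ := exists_of x
        rw [norm_of, norm_eq_zero] at hx
        rw [hx, of_zero] }
  __ := (inferInstance : Ring (AlgLocalMultiplier A))
  norm_mul_le x y := by
    obtain ⟨I, m, n, rfl, rfl⟩ := exists_of₂ x y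
    rw [of_mul]
    exact norm_mul_le m n

instance : CStarRing (AlgLocalMultiplier A) where
  norm_mul_self_le x := by
    obtain ⟨I, m, rfl⟩ := exists_of x
    rw [of_star, of_mul]
    exact CStarRing.norm_mul_self_le m

instance : NormedAlgebra ℂ (AlgLocalMultiplier A) where
  norm_smul_le c x := by
    obtain ⟨I, m, rfl⟩ := exists_of x
    rw [of_smul]
    exact norm_smul_le c m

end AlgLocalMultiplier

/-- The local multiplier algebra `M_loc(A)`: the C⋆-algebraic direct limit (the completion of the
algebraic direct limit) of the multiplier algebras `M(I)` over the essential ideals `I` of `A`. -/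
def LocalMultiplier (A : Type*) [NonUnitalCStarAlgebra A] : Type _ :=
  UniformSpace.Completion (AlgLocalMultiplier A)

namespace LocalMultiplier

open UniformSpace

variable {A : Type*} [NonUnitalCStarAlgebra A]

instance : NormedRing (LocalMultiplier A) :=
  inferInstanceAs (NormedRing (Completion (AlgLocalMultiplier A)))

instance : NormedSpace ℂ (LocalMultiplier A) :=
  inferInstanceAs (NormedSpace ℂ (Completion (AlgLocalMultiplier A)))

instance : CompleteSpace (LocalMultiplier A) :=
  inferInstanceAs (CompleteSpace (Completion (AlgLocalMultiplier A)))

/-- The embedding of the algebraic direct limit into its completion. -/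
def ofAlg (x : AlgLocalMultiplier A) : LocalMultiplier A := (x : Completion (AlgLocalMultiplier A))

theorem denseRange_ofAlg : DenseRange (ofAlg (A := A)) := Completion.denseRange_coe

theorem continuous_ofAlg : Continuous (ofAlg (A := A)) :=
  Completion.continuous_coe (AlgLocalMultiplier A)

theorem norm_ofAlg (x : AlgLocalMultiplier A) : ‖ofAlg x‖ = ‖x‖ := Completion.norm_coe x

theorem ofAlg_add (x y : AlgLocalMultiplier A) : ofAlg (x + y) = ofAlg x + ofAlg y :=
  Completion.coe_add x y

theorem ofAlg_mul (x y : AlgLocalMultiplier A) : ofAlg (x * y) = ofAlg x * ofAlg y :=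
  Completion.coe_mul x y

theorem ofAlg_smul (c : ℂ) (x : AlgLocalMultiplier A) : ofAlg (c • x) = c • ofAlg x :=
  Completion.coe_smul c x

/-- The involution is the continuous extension of that of the algebraic direct limit. -/
instance : Star (LocalMultiplier A) where
  star := Completion.map (star : AlgLocalMultiplier A → AlgLocalMultiplier A)

theorem continuous_star : Continuous (star : LocalMultiplier A → LocalMultiplier A) :=
  Completion.continuous_map

theorem ofAlg_star (x : AlgLocalMultiplier A) : ofAlg (star x) = star (ofAlg x) :=
  (Completion.map_coe (starₗᵢ ℂ (E := AlgLocalMultiplier A)).isometry.uniformContinuous x).symm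

instance : StarRing (LocalMultiplier A) where
  star_involutive x := by
    refine denseRange_ofAlg.induction_on (p := fun x => star (star x) = x) x
      (isClosed_eq (continuous_star.comp continuous_star) continuous_id) fun y => ?_
    rw [← ofAlg_star, ← ofAlg_star, star_star]
  star_mul x y := by
    refine denseRange_ofAlg.induction_on₂ (p := fun x y => star (x * y) = star y * star x)
      (isClosed_eq (continuous_star.comp continuous_mul)
        ((continuous_star.comp continuous_snd).mul (continuous_star.comp continuous_fst)))
      (fun a b => ?_) x y
    rw [← ofAlg_mul, ← ofAlg_star, ← ofAlg_star, ← ofAlg_star, ← ofAlg_mul, star_mul]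
  star_add x y := by
    refine denseRange_ofAlg.induction_on₂ (p := fun x y => star (x + y) = star x + star y)
      (isClosed_eq (continuous_star.comp continuous_add)
        ((continuous_star.comp continuous_fst).add (continuous_star.comp continuous_snd)))
      (fun a b => ?_) x y
    rw [← ofAlg_add, ← ofAlg_star, ← ofAlg_star, ← ofAlg_star, ← ofAlg_add, star_add]

instance : CStarRing (LocalMultiplier A) where
  norm_mul_self_le x := by
    refine denseRange_ofAlg.induction_on (p := fun x => ‖x‖ * ‖x‖ ≤ ‖star x * x‖) x
      (isClosed_le (continuous_norm.mul continuous_norm)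
        (continuous_norm.comp (continuous_star.mul continuous_id))) fun y => ?_
    rw [← ofAlg_star, ← ofAlg_mul, norm_ofAlg, norm_ofAlg]
    exact CStarRing.norm_mul_self_le y

theorem smul_mul (c : ℂ) (x y : LocalMultiplier A) : c • x * y = c • (x * y) := by
  refine denseRange_ofAlg.induction_on₂ (p := fun x y => c • x * y = c • (x * y))
    (isClosed_eq ((continuous_fst.const_smul c).mul continuous_snd)
      (continuous_mul.const_smul c)) (fun a b => ?_) x y
  rw [← ofAlg_mul, ← ofAlg_smul, ← ofAlg_smul, ← ofAlg_mul, smul_mul_assoc]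

theorem mul_smul (c : ℂ) (x y : LocalMultiplier A) : x * c • y = c • (x * y) := by
  refine denseRange_ofAlg.induction_on₂ (p := fun x y => x * c • y = c • (x * y))
    (isClosed_eq (continuous_fst.mul (continuous_snd.const_smul c))
      (continuous_mul.const_smul c)) (fun a b => ?_) x y
  rw [← ofAlg_mul, ← ofAlg_smul, ← ofAlg_smul, ← ofAlg_mul, mul_smul_comm]

instance : Algebra ℂ (LocalMultiplier A) := Algebra.ofModule smul_mul mul_smul

instance : NormedAlgebra ℂ (LocalMultiplier A) where
  norm_smul_le c x := norm_smul_le c x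

instance : StarModule ℂ (LocalMultiplier A) where
  star_smul c x := by
    refine denseRange_ofAlg.induction_on (p := fun x => star (c • x) = star c • star x) x
      (isClosed_eq (continuous_star.comp (continuous_const_smul c))
        (continuous_star.const_smul (star c))) fun y => ?_
    rw [← ofAlg_smul, ← ofAlg_star, ← ofAlg_star, ← ofAlg_smul, star_smul]

instance : CStarAlgebra (LocalMultiplier A) where

instance : PartialOrder (LocalMultiplier A) := CStarAlgebra.spectralOrder _

instance : StarOrderedRing (LocalMultiplier A) := CStarAlgebra.spectralOrderedRing _

/-- The canonical map `M(I) → M_loc(A)` for an essential ideal `I`. -/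
def ofMultiplier (I : EssentialIdeal A) (m : I.Mult) : LocalMultiplier A :=
  ofAlg (AlgLocalMultiplier.of I m)

/-- The canonical embedding `A ⊆ M(A) ⊆ M_loc(A)`. -/
def ofElem (a : A) : LocalMultiplier A :=
  ofMultiplier ⟨ClosedIdeal.whole A, ClosedIdeal.whole_isEssential⟩
    (DoubleCentralizer.coe ℂ (⟨a, ClosedIdeal.mem_whole a⟩ : ClosedIdeal.whole A))

/-- The canonical inclusion `M(J) ⊆ M_loc(J) ⊆ M_loc(A)` for an arbitrary closed ideal `J` of `A`:
a multiplier of `J` is extended by zero to the essential ideal `J ⊕ J^⊥`. -/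
def ofIdealMultiplier (J : ClosedIdeal A) (m : 𝓜(ℂ, J)) : LocalMultiplier A :=
  ofMultiplier ⟨J.sumPerp, J.sumPerp_isEssential⟩ (J.extendByZero m)

end LocalMultiplier

/-! ### Inclusions `A ⊆ B` of C⋆-algebras -/

section Inclusion

variable {B : Type*} [NonUnitalCStarAlgebra B]

/-- `A` is a maximal abelian C⋆-subalgebra (masa) of `B`. -/
def IsMasa (A : NonUnitalStarSubalgebra ℂ B) : Prop :=
  Maximal (fun C : NonUnitalStarSubalgebra ℂ B =>
    IsClosed (C : Set B) ∧ ∀ x ∈ C, ∀ y ∈ C, x * y = y * x) A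

/-- `n ∈ B` normalises `A` if `n⋆ A n ⊆ A` and `n A n⋆ ⊆ A`. -/
def IsNormaliser (A : NonUnitalStarSubalgebra ℂ B) (n : B) : Prop :=
  ∀ a ∈ A, star n * a * n ∈ A ∧ n * a * star n ∈ A

/-- The inclusion `A ⊆ B` is regular if the normalisers span a dense subspace of `B`. -/
def IsRegularInclusion (A : NonUnitalStarSubalgebra ℂ B) : Prop :=
  Dense (Submodule.span ℂ {n : B | IsNormaliser A n} : Set B)

/-- `D` is a hereditary C⋆-subalgebra of `A` (positivity in `A` and in `B` agree). -/
structure IsHereditarySubalgebra [PartialOrder B] (A D : NonUnitalStarSubalgebra ℂ B) : Prop where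
  le : D ≤ A
  isClosed : IsClosed (D : Set B)
  mem_of_le : ∀ a ∈ A, ∀ d ∈ D, 0 ≤ a → a ≤ d → a ∈ D

/-- The inclusion `A ⊆ B` is aperiodic: the Banach `A`-bimodule `B / A` is aperiodic, that is, for
every `ε > 0`, every nonzero hereditary subalgebra `D ⊆ A` and every `x ∈ B / A` (the class of some
`b ∈ B`) there is `a ∈ D` with `a ≥ 0`, `‖a‖ = 1` and `‖a x a‖ < ε` in the quotient norm. -/
def IsAperiodicInclusion [PartialOrder B] (A : NonUnitalStarSubalgebra ℂ B) : Prop :=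
  ∀ ε : ℝ, 0 < ε → ∀ D : NonUnitalStarSubalgebra ℂ B, IsHereditarySubalgebra A D → D ≠ ⊥ →
    ∀ b : B, ∃ a ∈ D, 0 ≤ a ∧ ‖a‖ = 1 ∧
      ‖(Submodule.Quotient.mk (a * b * a) : B ⧸ A.toNonUnitalSubalgebra.toSubmodule)‖ < ε

/-- A slice of `A ⊆ B`: a closed linear subspace `W` of `B` consisting of normalisers, with
`A W + W A ⊆ W` and `W⋆ W + W W⋆ ⊆ A`. -/
structure IsSlice (A : NonUnitalStarSubalgebra ℂ B) (W : Submodule ℂ B) : Prop where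
  isClosed : IsClosed (W : Set B)
  isNormaliser : ∀ w ∈ W, IsNormaliser A w
  mul_mem_left : ∀ a ∈ A, ∀ w ∈ W, a * w ∈ W
  mul_mem_right : ∀ a ∈ A, ∀ w ∈ W, w * a ∈ W
  star_mul_mem : ∀ v ∈ W, ∀ w ∈ W, star v * w ∈ A
  mul_star_mem : ∀ v ∈ W, ∀ w ∈ W, v * star w ∈ A

/-- For a slice `W`, the intersection `W ∩ A` is a closed ideal of `A`. -/
def IsSlice.interIdeal {A : NonUnitalStarSubalgebra ℂ B} [IsClosed (A : Set B)]
    {W : Submodule ℂ B} (hW : IsSlice A W) : ClosedIdeal A where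
  carrier := {a | (a : B) ∈ W}
  add_mem' ha hb := W.add_mem ha hb
  zero_mem' := W.zero_mem
  smul_mem' c _ ha := W.smul_mem c ha
  isClosed' := hW.isClosed.preimage continuous_subtype_val
  mul_mem_left' a _ hx := hW.mul_mem_left a a.2 _ hx
  mul_mem_right' a _ hx := hW.mul_mem_right a a.2 _ hx

open scoped CStarAlgebra in
/-- A local (conditional) expectation for `A ⊆ B`: a completely positive contractive linear map
`E : B → M_loc(A)` which restricts to the canonical embedding on `A`. -/
structure IsLocalExpectation [PartialOrder B] [StarOrderedRing B]
    (A : NonUnitalStarSubalgebra ℂ B) [IsClosed (A : Set B)]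
    (E : B →CP LocalMultiplier A) : Prop where
  contractive : ∀ b : B, ‖E b‖ ≤ ‖b‖
  apply_coe : ∀ a : A, E (a : B) = LocalMultiplier.ofElem a

end Inclusion

end

/-!
A masa is its own relative commutant. Let `n` be a normaliser and `0 ≠ d ∈ A`. Either `d n d`
commutes with `A`, and then it lies in `A`, or the partial homeomorphism of the spectrum of `A`
induced by the normaliser `d n d` moves some character; separating that character from its image by
elements with product zero yields `g ∈ A` with `d g ≠ 0` and `(d g) n (d g) = 0`. Hence every
element of the span of the normalisers is compressed into `A` by a nonzero element of each nonzero
principal ideal of `A`. Since this span is dense, the inclusion is aperiodic.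

By Choi's multiplicative domain argument a local expectation is `A`-bimodular. As `A` is central in
`M_loc(A)` and an essential ideal of `A` detects the elements of `M_loc(A)`, an element of
`M_loc(A)` that is compressed to zero in every nonzero principal ideal of `A` vanishes. Applied to
`E s - F s` this gives uniqueness. Applied to `E (w y)` for `w` in a slice `W` and
`y ∈ (W ∩ A)^⊥` it shows that `E w` annihilates `(W ∩ A)^⊥`, whereas `E w` acts on `W ∩ A` as
multiplication by `w`; so `E w` is the multiplier of `W ∩ A` given by `w`, extended by zero.
-/

noncomputable section

open Filter Topology

section CompletelyPositive

open scoped CStarAlgebra WithCStarModule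

variable {B M : Type*} [NonUnitalCStarAlgebra B] [PartialOrder B] [StarOrderedRing B]
  [NonUnitalCStarAlgebra M] [PartialOrder M] [StarOrderedRing M]

-- Instance search does not find the hypotheses of `CStarAlgebra.nonneg_iff_eq_mul_star_self` on
-- `CStarMatrix` directly; going through an arbitrary C⋆-algebra avoids this.
theorem exists_eq_mul_star_self_of_nonneg {p : M} (hp : 0 ≤ p) : ∃ s, p = s * star s :=
  CStarAlgebra.nonneg_iff_eq_mul_star_self.1 hp

theorem exists_map_mul_star_eq_inner {ι : Type*} [Fintype ι] (E : B →CP M) (v : ι → B) :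
    ∃ ξ : ι → C⋆ᵐᵒᵈ(M, ι → M), ∀ i j, E (v i * star (v j)) = inner M (ξ j) (ξ i) := by
  classical
  rcases isEmpty_or_nonempty ι with _ | ⟨⟨k⟩⟩
  · exact ⟨isEmptyElim, isEmptyElim⟩
  let V : CStarMatrix ι ι B := CStarMatrix.ofMatrix fun i j => if j = k then v i else 0
  have gram_eq (i j) : (V * star V) i j = v i * star (v j) := by
    have V_apply (i l : ι) : V i l = if l = k then v i else 0 := rfl
    simp [CStarMatrix.mul_apply, CStarMatrix.star_apply, V_apply]
  obtain ⟨N, hN⟩ := exists_eq_mul_star_self_of_nonneg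
    (E.map_cstarMatrix_nonneg _ (mul_star_self_nonneg V))
  refine ⟨fun i => (WithCStarModule.equiv M (ι → M)).symm (N i), fun i j => ?_⟩
  calc E (v i * star (v j)) = ((V * star V).map E) i j := by rw [CStarMatrix.map_apply, gram_eq]
    _ = (N * star N) i j := by rw [hN]
    _ = ∑ k, N i k * star (N j k) := by
      simp only [CStarMatrix.mul_apply, CStarMatrix.star_apply]

theorem norm_sq_map_mul_sub_mul_map_mul_le (E : B →CP M) {x y z : B} {m : M}
    (hy : ‖E (y * star y)‖ ≤ 1) :
    ‖E (x * star z) - m * E (y * star z)‖ ^ 2 ≤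
      ‖E (x * star x) - m * E (y * star x) - E (x * star y) * star m + m * star m‖ *
        ‖E (z * star z)‖ := by
  -- This is the Cauchy-Schwarz inequality for the vectors that represent `z` and `x - m y`.
  obtain ⟨ξ, hξ⟩ := exists_map_mul_star_eq_inner E ![x, y, z]
  let ζ := ξ 0 - m • ξ 1
  have inner_z_ζ : inner M (ξ 2) ζ = E (x * star z) - m * E (y * star z) := by
    simp only [ζ, CStarModule.inner_sub_right, CStarModule.inner_op_smul_right, ← hξ,
      Matrix.cons_val]
  have inner_ζ_ζ : inner M ζ ζ = E (x * star x) - m * E (y * star x) - E (x * star y) * star m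
        + m * E (y * star y) * star m := by
    simp only [ζ, CStarModule.inner_sub_right, CStarModule.inner_sub_left,
      CStarModule.inner_op_smul_right, CStarModule.inner_op_smul_left, ← hξ, Matrix.cons_val]
    noncomm_ring
  have inner_ζ_ζ_le : inner M ζ ζ ≤
      E (x * star x) - m * E (y * star x) - E (x * star y) * star m + m * star m := by
    rw [inner_ζ_ζ]
    gcongr
    calc m * E (y * star y) * star m ≤ ‖E (y * star y)‖ • (m * star m) :=
          CStarAlgebra.star_right_conjugate_le_norm_smul
            (.of_nonneg (map_nonneg E (mul_star_self_nonneg y)))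
      _ ≤ m * star m := smul_le_of_le_one_left (mul_star_self_nonneg m) hy
  calc ‖E (x * star z) - m * E (y * star z)‖ ^ 2 = ‖inner M (ξ 2) ζ‖ ^ 2 := by rw [inner_z_ζ]
    _ ≤ (‖ξ 2‖ * ‖ζ‖) ^ 2 := by gcongr; exact CStarModule.norm_inner_le _
    _ = ‖inner M ζ ζ‖ * ‖inner M (ξ 2) (ξ 2)‖ := by
      rw [mul_pow, mul_comm, CStarModule.norm_sq_eq M, CStarModule.norm_sq_eq M]
    _ ≤ _ := by
      rw [← show E (z * star z) = inner M (ξ 2) (ξ 2) from hξ 2 2]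
      gcongr
      exact CStarAlgebra.norm_le_norm_of_nonneg_of_le CStarModule.inner_self_nonneg inner_ζ_ζ_le

theorem map_mul_of_map_mul_star_self {E : B →CP M} (hE : ∀ b, ‖E b‖ ≤ ‖b‖) {a : B}
    (ha : E (a * star a) = E a * star (E a)) (z : B) : E (a * z) = E a * E z := by
  have h_approx := CStarAlgebra.increasingApproximateUnit B
  have := h_approx.neBot
  set l := CStarAlgebra.approximateUnit B
  -- Along the approximate unit, `bound` tends to `E (a * star a) - E a * star (E a) = 0`.
  set bound : B → M := fun e =>
    E (a * star a) - E a * E (e * star a) - E (a * e) * star (E a) + E a * star (E a)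
  have hcont : Continuous E := map_continuous E
  have left_tendsto (b : B) : Tendsto (fun e => E (e * b)) l (𝓝 (E b)) :=
    (hcont.tendsto _).comp (h_approx.tendsto_mul_right b)
  have right_tendsto : Tendsto (fun e => E (a * e)) l (𝓝 (E a)) :=
    (hcont.tendsto _).comp (h_approx.tendsto_mul_left a)
  have bound_tendsto : Tendsto (fun e => ‖bound e‖ * ‖E (star z * z)‖) l (𝓝 0) := by
    have := ((((left_tendsto (star a)).const_mul (E a)).const_sub (E (a * star a))).sub
      (right_tendsto.mul_const (star (E a)))).add_const (E a * star (E a))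
    rw [map_star, ha] at this
    simpa [bound, ha] using this.norm.mul_const ‖E (star z * z)‖
  have h_le : ∀ᶠ e in l, ‖E (a * z) - E a * E (e * z)‖ ^ 2 ≤ ‖bound e‖ * ‖E (star z * z)‖ := by
    filter_upwards [h_approx.eventually_star_eq, h_approx.eventually_norm] with e he he1
    have : ‖E (e * star e)‖ ≤ 1 := (hE _).trans <| by
      rw [CStarRing.norm_self_mul_star]; exact mul_le_one₀ he1 (norm_nonneg e) he1
    simpa [he] using norm_sq_map_mul_sub_mul_map_mul_le E (x := a) (z := star z) (m := E a) this
  have sq_tendsto : Tendsto (fun e => ‖E (a * z) - E a * E (e * z)‖ ^ 2) l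
      (𝓝 (‖E (a * z) - E a * E z‖ ^ 2)) :=
    (((left_tendsto z).const_mul (E a)).const_sub (E (a * z))).norm.pow 2
  have sq_nonpos := le_of_tendsto_of_tendsto sq_tendsto bound_tendsto h_le
  rwa [sq_nonpos_iff, norm_eq_zero, sub_eq_zero] at sq_nonpos

end CompletelyPositive

section Masa

variable {B : Type*} [NonUnitalCStarAlgebra B] {A : NonUnitalStarSubalgebra ℂ B}

theorem IsMasa.mul_comm (hA : IsMasa A) {a b : B} (ha : a ∈ A) (hb : b ∈ A) : a * b = b * a :=
  hA.1.2 a ha b hb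

theorem IsMasa.mem_of_isSelfAdjoint_of_comm (hA : IsMasa A) {x : B} (hx : IsSelfAdjoint x)
    (hcomm : ∀ a ∈ A, x * a = a * x) : x ∈ A := by
  let S : Set B := insert x A
  have star_S : star S = S := by
    ext b
    rw [Set.mem_star, Set.mem_insert_iff, Set.mem_insert_iff, star_eq_iff_star_eq, hx.star_eq,
      eq_comm, SetLike.mem_coe, SetLike.mem_coe, star_mem_iff]
  have comm_S : ∀ a ∈ S, ∀ b ∈ S, a * b = b * a := by
    rintro a (rfl | ha) b (rfl | hb)
    exacts [rfl, hcomm b hb, (hcomm a ha).symm, hA.mul_comm ha hb]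
  let C := NonUnitalStarSubalgebra.centralizer ℂ
    (NonUnitalStarSubalgebra.centralizer ℂ S : Set B)
  have coe_C : (C : Set B) = S.centralizer.centralizer := by
    rw [NonUnitalStarSubalgebra.coe_centralizer_centralizer, star_S, Set.union_self]
  have S_subset_C : S ⊆ C := coe_C ▸ Set.subset_centralizer_centralizer
  have C_le : C ≤ A := hA.2
    ⟨coe_C ▸ Set.isClosed_centralizer _, fun a ha b hb => by
      rw [← SetLike.mem_coe, coe_C] at ha hb
      exact Set.centralizer_centralizer_comm_of_comm comm_S a ha b hb⟩
    fun a ha => S_subset_C (Set.mem_insert_of_mem x ha)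
  exact C_le (S_subset_C (Set.mem_insert x A))

theorem IsMasa.mem_of_comm (hA : IsMasa A) {x : B} (hx : ∀ a ∈ A, x * a = a * x) : x ∈ A := by
  have hx' : ∀ a ∈ A, star x * a = a * star x := fun a ha => by
    simpa using (congrArg star (hx _ (star_mem ha))).symm
  rw [← realPart_add_I_smul_imaginaryPart x]
  refine add_mem (hA.mem_of_isSelfAdjoint_of_comm (realPart x).2 fun a ha => ?_)
    (SMulMemClass.smul_mem _
      (hA.mem_of_isSelfAdjoint_of_comm (imaginaryPart x).2 fun a ha => ?_))
  · simp only [realPart_apply_coe, smul_mul_assoc, mul_smul_comm, add_mul, mul_add, hx a ha,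
      hx' a ha]
  · simp only [imaginaryPart_apply_coe, smul_mul_assoc, mul_smul_comm, sub_mul, mul_sub, hx a ha,
      hx' a ha]

end Masa

section Character

theorem exists_apply_ne_zero_apply_eq_zero {𝕜 A : Type*} [Field 𝕜] [StarRing 𝕜] [NonUnitalRing A]
    [StarAddMonoid A] [Module 𝕜 A] {χ₁ χ₂ : A →⋆ₙₐ[𝕜] 𝕜} (hχ : χ₁ ≠ 0) (hne : χ₁ ≠ χ₂) :
    ∃ a : A, χ₁ a ≠ 0 ∧ χ₂ a = 0 := by
  obtain ⟨e, he⟩ := DFunLike.ne_iff.1 hχ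
  obtain ⟨f, hf⟩ := DFunLike.ne_iff.1 hne
  refine ⟨f * e - χ₂ f • e, ?_, ?_⟩
  · rw [map_sub, map_mul, map_smul, smul_eq_mul, ← sub_mul]
    exact mul_ne_zero (sub_ne_zero.2 hf) he
  · rw [map_sub, map_mul, map_smul, smul_eq_mul, sub_self]

variable {A : Type*} [NonUnitalCStarAlgebra A]

theorem exists_character_ne_zero (hA : ∀ x y : A, x * y = y * x) {q : A} (hq : q ≠ 0) :
    ∃ χ : A →⋆ₙₐ[ℂ] ℂ, χ q ≠ 0 := by
  let _ : NonUnitalCommCStarAlgebra A := { ‹NonUnitalCStarAlgebra A› with mul_comm := hA }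
  have gelfand_ne_zero : WeakDual.gelfandTransform ℂ (Unitization ℂ A) q ≠ 0 := by
    rw [Ne, (injective_iff_map_eq_zero' _).1 (gelfandTransform_isometry _).injective]
    exact fun h => hq (Unitization.inr_injective h)
  obtain ⟨φ, hφ⟩ := DFunLike.ne_iff.1 gelfand_ne_zero
  exact ⟨(φ : Unitization ℂ A →⋆ₙₐ[ℂ] ℂ).comp (Unitization.inrNonUnitalStarAlgHom ℂ A), hφ⟩

open scoped ComplexOrder in
theorem exists_mul_eq_zero_of_ne {χ₁ χ₂ : A →⋆ₙₐ[ℂ] ℂ} (hχ₁ : χ₁ ≠ 0) (hχ₂ : χ₂ ≠ 0)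
    (hne : χ₁ ≠ χ₂) : ∃ u v : A, u * v = 0 ∧ χ₁ u ≠ 0 ∧ χ₂ v ≠ 0 := by
  let _ : PartialOrder A := CStarAlgebra.spectralOrder A
  have : StarOrderedRing A := CStarAlgebra.spectralOrderedRing A
  obtain ⟨a, ha₁, ha₂⟩ := exists_apply_ne_zero_apply_eq_zero hχ₁ hne
  obtain ⟨b, hb₂, hb₁⟩ := exists_apply_ne_zero_apply_eq_zero hχ₂ hne.symm
  set h := star a * a - star b * b with hh
  have h_sub : h⁺ - h⁻ = h := CFC.posPart_sub_negPart h
    ((IsSelfAdjoint.star_mul_self a).sub (IsSelfAdjoint.star_mul_self b))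
  have h₁ : 0 < χ₁ h := by
    rw [hh, map_sub, map_mul, map_mul, hb₁, mul_zero, sub_zero, map_star]
    exact (star_mul_self_nonneg _).lt_of_ne' (mul_ne_zero (star_ne_zero.2 ha₁) ha₁)
  have h₂ : χ₂ h < 0 := by
    rw [hh, map_sub, map_mul, map_mul, ha₂, mul_zero, zero_sub, neg_lt_zero, map_star]
    exact (star_mul_self_nonneg _).lt_of_ne' (mul_ne_zero (star_ne_zero.2 hb₂) hb₂)
  refine ⟨h⁺, h⁻, CFC.posPart_mul_negPart h, fun h0 => ?_, fun h0 => ?_⟩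
  · rw [← h_sub, map_sub, h0, zero_sub, neg_pos] at h₁
    exact h₁.not_ge (map_nonneg χ₁ (CFC.negPart_nonneg h))
  · rw [← h_sub, map_sub, h0, sub_zero] at h₂
    exact h₂.not_ge (map_nonneg χ₂ (CFC.posPart_nonneg h))

end Character

section Compression

variable {B : Type*} [NonUnitalCStarAlgebra B] {A : NonUnitalStarSubalgebra ℂ B} {n : B}

namespace IsNormaliser

theorem mul_mul (hn : IsNormaliser A n) {c d : B} (hc : c ∈ A) (hd : d ∈ A) :
    IsNormaliser A (c * n * d) := fun a ha => by
  have h₁ := mul_mem (mul_mem (star_mem hd)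
    (hn _ (mul_mem (mul_mem (star_mem hc) ha) hc)).1) hd
  have h₂ := mul_mem (mul_mem hc (hn _ (mul_mem (mul_mem hd ha) (star_mem hd))).2) (star_mem hc)
  simp only [star_mul, mul_assoc] at h₁ h₂ ⊢
  exact ⟨h₁, h₂⟩

theorem star_mul_self_mem (hn : IsNormaliser A n) {c d : B} (hc : c ∈ A) (hd : d ∈ A) :
    star (c * n * d) * (c * n * d) ∈ A := by
  have h := mul_mem (mul_mem (star_mem hd) (hn _ (mul_mem (star_mem hc) hc)).1) hd
  simpa only [star_mul, mul_assoc] using h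

theorem mul_star_self_mem (hn : IsNormaliser A n) {c d : B} (hc : c ∈ A) (hd : d ∈ A) :
    (c * n * d) * star (c * n * d) ∈ A := by
  have h := mul_mem (mul_mem hc (hn _ (mul_mem hd (star_mem hd))).2) (star_mem hc)
  simpa only [star_mul, mul_assoc] using h

/-- The linear map `a ↦ n⋆ a n` on `A` given by a normaliser `n` of `A`. -/
def conj (hn : IsNormaliser A n) : A →ₗ[ℂ] A where
  toFun a := ⟨star n * a * n, (hn a a.2).1⟩
  map_add' a b := Subtype.ext <| by
    simp only [NonUnitalStarSubalgebra.coe_add, mul_add, add_mul]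
  map_smul' c a := Subtype.ext <| by
    simp only [NonUnitalStarSubalgebra.coe_smul, mul_smul_comm, smul_mul_assoc, RingHom.id_apply]

theorem coe_conj (hn : IsNormaliser A n) (a : A) : (hn.conj a : B) = star n * a * n := rfl

theorem conj_star (hn : IsNormaliser A n) (a : A) : hn.conj (star a) = star (hn.conj a) :=
  Subtype.ext <| by simp only [coe_conj, StarMemClass.coe_star, star_mul, star_star, mul_assoc]

variable (hA : ∀ a b : A, a * b = b * a) (hl : star n * n ∈ A) (hr : n * star n ∈ A)
include hA hr

theorem mul_conj_mul (hn : IsNormaliser A n) (a b : A) :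
    ⟨star n * n, hl⟩ * hn.conj (a * b) = hn.conj a * hn.conj b := Subtype.ext <| by
  have h_comm : n * star n * (a : B) = a * (n * star n) := congrArg Subtype.val (hA ⟨_, hr⟩ a)
  calc star n * n * (star n * (a * b : B) * n) = star n * (n * star n * a) * b * n := by
        noncomm_ring
    _ = star n * a * n * (star n * b * n) := by rw [h_comm]; noncomm_ring

theorem character_conj_eq_zero (hn : IsNormaliser A n) {χ : A →⋆ₙₐ[ℂ] ℂ}
    (hχ : χ ⟨star n * n, hl⟩ = 0) (a : A) : χ (hn.conj a) = 0 := by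
  have h := congrArg χ (hn.mul_conj_mul hA hl hr (star a) a)
  rw [map_mul χ, map_mul χ, hχ, zero_mul, hn.conj_star, map_star] at h
  exact (CStarRing.star_mul_self_eq_zero_iff _).1 h.symm

/-- The character `a ↦ χ (n⋆ a n) / χ (n⋆ n)` of `A`, the image of the character `χ` under the
partial homeomorphism of the spectrum of `A` induced by the normaliser `n`. -/
def conjCharacter (hn : IsNormaliser A n) (χ : A →⋆ₙₐ[ℂ] ℂ) (hχ : χ ⟨star n * n, hl⟩ ≠ 0) :
    A →⋆ₙₐ[ℂ] ℂ where
  toFun a := (χ ⟨star n * n, hl⟩)⁻¹ * χ (hn.conj a)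
  map_smul' c a := by
    rw [map_smul, map_smul, MonoidHom.id_apply, mul_smul_comm]
  map_zero' := by rw [map_zero, map_zero, mul_zero]
  map_add' a b := by rw [map_add, map_add, mul_add]
  map_mul' a b := by
    have h := congrArg χ (hn.mul_conj_mul hA hl hr a b)
    rw [map_mul χ, map_mul χ] at h
    field_simp
    exact h
  map_star' a := by
    have star_eq : star (⟨star n * n, hl⟩ : A) = ⟨star n * n, hl⟩ :=
      Subtype.ext (IsSelfAdjoint.star_mul_self n)
    rw [hn.conj_star, map_star χ, star_mul', star_inv₀, ← map_star χ ⟨star n * n, hl⟩,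
      star_eq]

theorem character_conj (hn : IsNormaliser A n) {χ : A →⋆ₙₐ[ℂ] ℂ}
    (hχ : χ ⟨star n * n, hl⟩ ≠ 0) (a : A) :
    χ (hn.conj a) = χ ⟨star n * n, hl⟩ * hn.conjCharacter hA hl hr χ hχ a :=
  (mul_inv_cancel_left₀ hχ _).symm

theorem conjCharacter_ne_zero (hn : IsNormaliser A n) {χ : A →⋆ₙₐ[ℂ] ℂ}
    (hχ : χ ⟨star n * n, hl⟩ ≠ 0) : hn.conjCharacter hA hl hr χ hχ ≠ 0 := fun h => by
  have conj_mul_star : hn.conj ⟨n * star n, hr⟩ = ⟨star n * n, hl⟩ * ⟨star n * n, hl⟩ :=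
    Subtype.ext <| by simp [coe_conj, mul_assoc]
  have h_sq := hn.character_conj hA hl hr hχ ⟨n * star n, hr⟩
  rw [conj_mul_star, map_mul, h, NonUnitalStarAlgHom.zero_apply, mul_zero] at h_sq
  exact hχ (mul_self_eq_zero.1 h_sq)

theorem exists_conjCharacter_ne [IsClosed (A : Set B)] (hn : IsNormaliser A n) {f : A}
    (hf : n * f ≠ f * n) :
    ∃ (χ : A →⋆ₙₐ[ℂ] ℂ) (hχ : χ ⟨star n * n, hl⟩ ≠ 0), χ ≠ hn.conjCharacter hA hl hr χ hχ := by
  let k : A := ⟨star n * n, hl⟩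
  let q : A := hn.conj (star f * f) - hn.conj (star f) * f - star f * hn.conj f + star f * k * f
  have coe_q : (q : B) = star (f * n - n * f) * (f * n - n * f) := by
    simp only [q, k, coe_conj, star_mul, star_sub, NonUnitalStarSubalgebra.coe_mul,
      NonUnitalStarSubalgebra.coe_add, NonUnitalStarSubalgebra.coe_sub, StarMemClass.coe_star]
    noncomm_ring
  have q_ne_zero : q ≠ 0 := fun h => hf <| by
    rw [h, ZeroMemClass.coe_zero, eq_comm, CStarRing.star_mul_self_eq_zero_iff] at coe_q
    exact (sub_eq_zero.1 coe_q).symm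
  -- A character fixed by the partial homeomorphism of `n` would vanish at `q`.
  obtain ⟨χ, hχq⟩ := exists_character_ne_zero hA q_ne_zero
  have hχ : χ k ≠ 0 := fun h => hχq <| by
    simp only [q, map_mul, map_add, map_sub, hn.character_conj_eq_zero hA hl hr h, h]
    simp
  refine ⟨χ, hχ, fun h => hχq ?_⟩
  have χ_conj (a : A) : χ (hn.conj a) = χ k * χ a := by
    rw [hn.character_conj hA hl hr hχ, ← h]
  simp only [q, map_mul, map_add, map_sub, χ_conj, map_star]
  ring

include hl in
theorem exists_mul_mul_eq_zero [IsClosed (A : Set B)] (hn : IsNormaliser A n) {f : A}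
    (hf : n * f ≠ f * n) : ∃ g : A, n * g ≠ 0 ∧ g * n * g = 0 := by
  obtain ⟨χ, hχ, hne⟩ := hn.exists_conjCharacter_ne hA hl hr hf
  obtain ⟨u, v, huv, hu, hv⟩ := exists_mul_eq_zero_of_ne (fun h => hχ (by rw [h]; rfl))
    (hn.conjCharacter_ne_zero hA hl hr hχ) hne
  refine ⟨u * hn.conj v, fun h => ?_, ?_⟩
  · have h' : ⟨star n * n, hl⟩ * (u * hn.conj v) = (0 : A) := Subtype.ext <| by
      simp only [NonUnitalStarSubalgebra.coe_mul, mul_assoc, ZeroMemClass.coe_zero] at h ⊢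
      rw [h, mul_zero]
    have := congrArg χ h'
    rw [map_mul, map_mul, hn.character_conj hA hl hr hχ, map_zero] at this
    exact mul_ne_zero hχ (mul_ne_zero hu (mul_ne_zero hχ hv)) this
  · have h_comm : n * star n * (u : B) = u * (n * star n) := congrArg Subtype.val (hA ⟨_, hr⟩ u)
    have huv' : (u * v : B) = 0 := congrArg Subtype.val huv
    calc ((u * hn.conj v : A) : B) * n * (u * hn.conj v : A)
        = (hn.conj v * u : A) * n * (hn.conj v * u : A) := by rw [hA u]
      _ = hn.conj v * (u * (n * star n)) * v * n * u := by
          simp only [NonUnitalStarSubalgebra.coe_mul, coe_conj, mul_assoc]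
      _ = hn.conj v * (n * star n) * (u * v) * n * u := by rw [← h_comm]; noncomm_ring
      _ = 0 := by rw [huv']; simp

end IsNormaliser

namespace IsMasa

variable [IsClosed (A : Set B)]

theorem exists_compression_normaliser (hA : IsMasa A) (hn : IsNormaliser A n) {d : B} (hd : d ∈ A)
    (hd0 : d ≠ 0) : ∃ g ∈ A, d * g ≠ 0 ∧ d * g * n * (d * g) ∈ A := by
  by_cases hdn : d * n * d ∈ A
  · refine ⟨star d, star_mem hd, (CStarRing.mul_star_self_ne_zero_iff d).2 hd0, ?_⟩
    rw [hA.mul_comm hd (star_mem hd)]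
    nth_rw 2 [hA.mul_comm (star_mem hd) hd]
    simpa only [mul_assoc] using mul_mem (mul_mem (star_mem hd) hdn) (star_mem hd)
  · obtain ⟨f, hf, hfd⟩ : ∃ f ∈ A, d * n * d * f ≠ f * (d * n * d) := by
      by_contra! h
      exact hdn (hA.mem_of_comm h)
    obtain ⟨g, hg0, hg⟩ := (hn.mul_mul hd hd).exists_mul_mul_eq_zero
      (fun a b => Subtype.ext (hA.mul_comm a.2 b.2)) (hn.star_mul_self_mem hd hd)
      (hn.mul_star_self_mem hd hd) (f := ⟨f, hf⟩) hfd
    refine ⟨g, g.2, fun h => hg0 (by rw [mul_assoc, h, mul_zero]), ?_⟩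
    nth_rw 1 [hA.mul_comm hd g.2]
    convert zero_mem A
    rw [← hg]
    simp only [mul_assoc]

theorem exists_compression (hA : IsMasa A) {s : B}
    (hs : s ∈ Submodule.span ℂ {n : B | IsNormaliser A n}) :
    ∀ d ∈ A, d ≠ 0 → ∃ g ∈ A, d * g ≠ 0 ∧ d * g * s * (d * g) ∈ A := by
  induction hs using Submodule.span_induction with
  | mem n hn => exact fun d hd hd0 => hA.exists_compression_normaliser hn hd hd0
  | zero =>
    refine fun d hd hd0 => ⟨star d, star_mem hd, (CStarRing.mul_star_self_ne_zero_iff d).2 hd0, ?_⟩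
    rw [mul_zero, zero_mul]
    exact zero_mem A
  | add s t _ _ ihs iht =>
    intro d hd hd0
    obtain ⟨g, hg, hg0, hgs⟩ := ihs d hd hd0
    obtain ⟨h, hh, hh0, hht⟩ := iht (d * g) (mul_mem hd hg) hg0
    refine ⟨g * h, mul_mem hg hh, by rwa [← mul_assoc], ?_⟩
    rw [← mul_assoc d g h, mul_add, add_mul]
    refine add_mem ?_ hht
    nth_rw 1 [hA.mul_comm (mul_mem hd hg) hh]
    simpa only [mul_assoc] using mul_mem (mul_mem hh hgs) hh
  | smul c s _ ih =>
    intro d hd hd0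
    obtain ⟨g, hg, hg0, hgs⟩ := ih d hd hd0
    refine ⟨g, hg, hg0, ?_⟩
    rw [mul_smul_comm, smul_mul_assoc]
    exact SMulMemClass.smul_mem c hgs

end IsMasa

end Compression

theorem eq_zero_of_isStarNormal_of_mul_self_eq_zero {A : Type*} [NonUnitalNormedRing A]
    [StarRing A] [CStarRing A] {x : A} [IsStarNormal x] (hx : x * x = 0) : x = 0 := by
  rw [← CStarRing.star_mul_self_eq_zero_iff, ← CStarRing.star_mul_self_eq_zero_iff (star x * x)]
  calc star (star x * x) * (star x * x) = star x * (x * star x) * x := by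
        rw [star_mul, star_star]; simp only [mul_assoc]
    _ = star x * star x * (x * x) := by rw [← star_comm_self' x]; simp only [mul_assoc]
    _ = 0 := by rw [hx, mul_zero]

namespace LocalMultiplier

variable {A : Type*} [NonUnitalCStarAlgebra A]

theorem norm_ofMultiplier (I : EssentialIdeal A) (m : I.Mult) : ‖ofMultiplier I m‖ = ‖m‖ := by
  rw [ofMultiplier, norm_ofAlg, AlgLocalMultiplier.norm_of]

/-- The canonical map `M(I) → M_loc(A)` as a homomorphism of star algebras. -/
def ofMultiplierHom (I : EssentialIdeal A) : I.Mult →⋆ₙₐ[ℂ] LocalMultiplier A where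
  toFun := ofMultiplier I
  map_smul' c m := by
    simp only [ofMultiplier, ← ofAlg_smul, AlgLocalMultiplier.of_smul, MonoidHom.id_apply]
  map_zero' := by rw [← norm_eq_zero, norm_ofMultiplier, norm_zero]
  map_add' m n := by simp only [ofMultiplier, ← ofAlg_add, AlgLocalMultiplier.of_add]
  map_mul' m n := by simp only [ofMultiplier, ← ofAlg_mul, AlgLocalMultiplier.of_mul]
  map_star' m := by simp only [ofMultiplier, ← ofAlg_star, AlgLocalMultiplier.of_star]

theorem ofMultiplier_res {I J : EssentialIdeal A} (h : I ≤ J) (m : I.Mult) :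
    ofMultiplier J (EssentialIdeal.res I J h m) = ofMultiplier I m :=
  congrArg ofAlg (DirectLimit.eq_of_le (f := EssentialIdeal.res) ⟨I, m⟩ J h).symm

/-- The canonical embedding `A ⊆ M_loc(A)` as a homomorphism of star algebras. -/
def ofElemHom : A →⋆ₙₐ[ℂ] LocalMultiplier A :=
  (ofMultiplierHom ⟨ClosedIdeal.whole A, ClosedIdeal.whole_isEssential⟩).comp
    (DoubleCentralizer.coeHom.comp
      { toFun := fun a => (⟨a, ClosedIdeal.mem_whole a⟩ : ClosedIdeal.whole A)
        map_smul' := fun _ _ => rfl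
        map_zero' := rfl
        map_add' := fun _ _ => rfl
        map_mul' := fun _ _ => rfl
        map_star' := fun _ => rfl })

theorem ofElem_zero : ofElem (0 : A) = 0 := map_zero ofElemHom

theorem ofElem_add (a b : A) : ofElem (a + b) = ofElem a + ofElem b := map_add ofElemHom a b

theorem ofElem_mul (a b : A) : ofElem (a * b) = ofElem a * ofElem b := map_mul ofElemHom a b

theorem ofElem_smul (c : ℂ) (a : A) : ofElem (c • a) = c • ofElem a := map_smul ofElemHom c a

theorem ofElem_star (a : A) : ofElem (star a) = star (ofElem a) := map_star ofElemHom a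

theorem norm_ofElem (a : A) : ‖ofElem a‖ = ‖a‖ := by
  rw [ofElem, norm_ofMultiplier, ← DoubleCentralizer.norm_fst, DoubleCentralizer.coe_fst,
    ContinuousLinearMap.opNorm_mul_apply]
  rfl

theorem continuous_ofElem : Continuous (ofElem (A := A)) :=
  (AddMonoidHomClass.isometry_of_norm (ofElemHom (A := A)) norm_ofElem).continuous

theorem ofElem_coe_eq_ofMultiplier (I : EssentialIdeal A) (x : I.ideal) :
    ofElem (x : A) = ofMultiplier I (DoubleCentralizer.coe ℂ x) := by
  rw [ofElem, ← ofMultiplier_res (J := I) (fun y _ => ClosedIdeal.mem_whole y)]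
  rfl

theorem ofMultiplier_mul_ofElem (I : EssentialIdeal A) (m : I.Mult) (x : I.ideal) :
    ofMultiplier I m * ofElem (x : A) = ofElem (m.fst x : A) := by
  rw [ofElem_coe_eq_ofMultiplier, ofElem_coe_eq_ofMultiplier]
  refine (map_mul (ofMultiplierHom I) m _).symm.trans (congrArg _ ?_)
  refine DoubleCentralizer.ext _ _ _ _ (Prod.ext (ContinuousLinearMap.ext fun y => ?_)
    (ContinuousLinearMap.ext fun y => ?_))
  exacts [ClosedIdeal.fst_mul m x y, m.central y x]

theorem ofIdealMultiplier_mul_ofElem (J : ClosedIdeal A) (m : DoubleCentralizer ℂ J)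
    (z : J.sumPerp) : ofIdealMultiplier J m * ofElem (z : A) = ofElem (m.fst (J.proj z) : A) :=
  ofMultiplier_mul_ofElem ⟨J.sumPerp, J.sumPerp_isEssential⟩ (J.extendByZero m) z

theorem norm_ofMultiplier_le {I : ClosedIdeal A} (hI : I.IsEssential) {J : EssentialIdeal A}
    {m : J.Mult} {C : ℝ} (hC : 0 ≤ C) (h : ∀ x ∈ I, ‖ofMultiplier J m * ofElem x‖ ≤ C * ‖x‖) :
    ‖ofMultiplier J m‖ ≤ C := by
  let K : EssentialIdeal A := ⟨J.ideal.inter I, J.essential.inter hI⟩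
  have hJK : J ≤ K := fun x hx => hx.1
  rw [← ofMultiplier_res hJK] at h ⊢
  rw [norm_ofMultiplier, ← DoubleCentralizer.norm_fst]
  refine ContinuousLinearMap.opNorm_le_bound _ hC fun x => ?_
  have hx := h x x.2.2
  rwa [ofMultiplier_mul_ofElem, norm_ofElem] at hx

theorem norm_le_of_norm_mul_ofElem_le {I : ClosedIdeal A} (hI : I.IsEssential)
    {y : LocalMultiplier A} {C : ℝ} (hC : 0 ≤ C) (h : ∀ x ∈ I, ‖y * ofElem x‖ ≤ C * ‖x‖) :
    ‖y‖ ≤ C := by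
  refine le_of_forall_pos_le_add fun ε hε => ?_
  obtain ⟨z, hz⟩ := denseRange_ofAlg.exists_dist_lt y (half_pos hε)
  obtain ⟨J, m, rfl⟩ := AlgLocalMultiplier.exists_of z
  change dist y (ofMultiplier J m) < ε / 2 at hz
  rw [dist_eq_norm] at hz
  have h_le : ‖ofMultiplier J m‖ ≤ C + ε / 2 := norm_ofMultiplier_le hI (by positivity) fun x hx =>
    calc ‖ofMultiplier J m * ofElem x‖ = ‖y * ofElem x - (y - ofMultiplier J m) * ofElem x‖ := by
          rw [sub_mul, sub_sub_cancel]
      _ ≤ ‖y * ofElem x‖ + ‖y - ofMultiplier J m‖ * ‖ofElem x‖ :=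
          (norm_sub_le _ _).trans (by gcongr; exact norm_mul_le _ _)
      _ ≤ C * ‖x‖ + ε / 2 * ‖x‖ := by rw [norm_ofElem]; gcongr; exact h x hx
      _ = (C + ε / 2) * ‖x‖ := (add_mul _ _ _).symm
  linarith [norm_le_norm_sub_add y (ofMultiplier J m)]

theorem eq_zero_of_mul_ofElem {I : ClosedIdeal A} (hI : I.IsEssential) {y : LocalMultiplier A}
    (h : ∀ x ∈ I, y * ofElem x = 0) : y = 0 :=
  norm_le_zero_iff.1 <| norm_le_of_norm_mul_ofElem_le hI le_rfl fun x hx => by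
    rw [h x hx, norm_zero, zero_mul]

section Commutative

variable (hA : ∀ a b : A, a * b = b * a)
include hA

theorem mul_ofElem_comm (y : LocalMultiplier A) (a : A) : y * ofElem a = ofElem a * y := by
  refine denseRange_ofAlg.induction_on (p := fun y => y * ofElem a = ofElem a * y) y
    (isClosed_eq (continuous_mul_const _) (continuous_const_mul _)) fun z => ?_
  obtain ⟨I, m, rfl⟩ := AlgLocalMultiplier.exists_of z
  change ofMultiplier I m * ofElem a = ofElem a * ofMultiplier I m
  refine sub_eq_zero.1 (eq_zero_of_mul_ofElem I.essential fun x hx => ?_)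
  rw [sub_mul, sub_eq_zero]
  calc ofMultiplier I m * ofElem a * ofElem x = ofMultiplier I m * ofElem x * ofElem a := by
        rw [mul_assoc, mul_assoc, ← ofElem_mul, hA, ofElem_mul]
    _ = ofElem a * ofElem (m.fst ⟨x, hx⟩ : A) := by
        rw [ofMultiplier_mul_ofElem I m ⟨x, hx⟩, ← ofElem_mul, hA, ofElem_mul]
    _ = ofElem a * ofMultiplier I m * ofElem x := by
        rw [mul_assoc, ofMultiplier_mul_ofElem I m ⟨x, hx⟩]

/-- The closed ideal of those elements of a commutative `A` that annihilate a given element of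
`M_loc(A)`. -/
def annihilator (y : LocalMultiplier A) : ClosedIdeal A where
  carrier := {a | y * ofElem a = 0}
  add_mem' {a b} (ha : y * ofElem a = 0) (hb : y * ofElem b = 0) :=
    show y * ofElem (a + b) = 0 by rw [ofElem_add, mul_add, ha, hb, add_zero]
  zero_mem' := show y * ofElem 0 = 0 by rw [ofElem_zero, mul_zero]
  smul_mem' c a (ha : y * ofElem a = 0) :=
    show y * ofElem (c • a) = 0 by rw [ofElem_smul, mul_smul_comm, ha, smul_zero]
  isClosed' := isClosed_eq (continuous_ofElem.const_mul y) continuous_const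
  mul_mem_left' a x (hx : y * ofElem x = 0) :=
    show y * ofElem (a * x) = 0 by rw [hA, ofElem_mul, ← mul_assoc, hx, zero_mul]
  mul_mem_right' a x (hx : y * ofElem x = 0) :=
    show y * ofElem (x * a) = 0 by rw [ofElem_mul, ← mul_assoc, hx, zero_mul]

theorem mem_annihilator {y : LocalMultiplier A} {a : A} :
    a ∈ annihilator hA y ↔ y * ofElem a = 0 := Iff.rfl

theorem eq_zero_of_compression {y : LocalMultiplier A}
    (h : ∀ d : A, d ≠ 0 → ∃ g : A, d * g ≠ 0 ∧ ofElem (d * g) * y * ofElem (d * g) = 0) :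
    y = 0 := by
  refine eq_zero_of_mul_ofElem (I := annihilator hA y) (fun d hd => ?_) fun x => id
  by_contra hd0
  obtain ⟨g, hc0, hcy⟩ := h d hd0
  set c := d * g
  have hc_perp : c ∈ (annihilator hA y).perp := (annihilator hA y).perp.mul_mem_right g hd
  have hcc_mem : c * c ∈ annihilator hA y := by
    rw [mem_annihilator, ofElem_mul, ← mul_assoc, mul_ofElem_comm hA y, hcy]
  have : IsStarNormal c := ⟨hA _ _⟩
  have : IsStarNormal (c * c) := ⟨hA _ _⟩
  have hccc : c * (c * c) = 0 := ClosedIdeal.perp_mul hc_perp hcc_mem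
  have hcc : c * c = 0 := eq_zero_of_isStarNormal_of_mul_self_eq_zero (by
    rw [mul_assoc, hccc, mul_zero])
  exact hc0 (eq_zero_of_isStarNormal_of_mul_self_eq_zero hcc)

end Commutative

end LocalMultiplier

section Aperiodic

theorem norm_mk_mul_mul_le {R B : Type*} [Ring R] [NonUnitalSeminormedRing B] [Module R B]
    {p : Submodule R B} {a b s : B} (ha : ‖a‖ ≤ 1) (hs : a * s * a ∈ p) :
    ‖(Submodule.Quotient.mk (a * b * a) : B ⧸ p)‖ ≤ ‖b - s‖ := by
  have mk_eq : (Submodule.Quotient.mk (a * b * a) : B ⧸ p) =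
      Submodule.Quotient.mk (a * (b - s) * a) := (Submodule.Quotient.eq _).2 <| by
    rwa [mul_sub, sub_mul, sub_sub_cancel]
  calc _ ≤ ‖a * (b - s) * a‖ := mk_eq ▸ Submodule.Quotient.norm_mk_le _ _
    _ ≤ ‖a‖ * ‖b - s‖ * ‖a‖ := norm_mul₃_le
    _ ≤ 1 * ‖b - s‖ * 1 := by gcongr
    _ = ‖b - s‖ := by rw [one_mul, mul_one]

variable {B : Type*} [NonUnitalCStarAlgebra B] [PartialOrder B] [StarOrderedRing B]
  {A D : NonUnitalStarSubalgebra ℂ B}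

theorem IsHereditarySubalgebra.star_mul_self_mem (hD : IsHereditarySubalgebra A D) {d g : B}
    (hd : d ∈ D) (hg : g ∈ A) : star (g * d) * (g * d) ∈ D := by
  have hgd : g * d ∈ A := mul_mem hg (hD.le hd)
  refine hD.mem_of_le _ (mul_mem (star_mem hgd) hgd) (‖star g * g‖ • (star d * d)) ?_
    (star_mul_self_nonneg _) ?_
  · rw [← Complex.coe_smul]
    exact SMulMemClass.smul_mem _ (mul_mem (star_mem hd) hd)
  · calc star (g * d) * (g * d) = star d * (star g * g) * d := by
          simp only [star_mul, mul_assoc]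
      _ ≤ ‖star g * g‖ • (star d * d) :=
          CStarAlgebra.star_left_conjugate_le_norm_smul (IsSelfAdjoint.star_mul_self g)

theorem IsMasa.exists_nonneg_compression [IsClosed (A : Set B)] (hA : IsMasa A) {s : B}
    (hs : s ∈ Submodule.span ℂ {n : B | IsNormaliser A n}) (hD : IsHereditarySubalgebra A D)
    (hD0 : D ≠ ⊥) : ∃ a ∈ D, 0 ≤ a ∧ ‖a‖ = 1 ∧ a * s * a ∈ A := by
  obtain ⟨d, hdD, hd0⟩ : ∃ d ∈ D, d ≠ 0 := by
    by_contra! h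
    exact hD0 (eq_bot_iff.2 fun x hx => (NonUnitalStarAlgebra.mem_bot).2 (h x hx))
  obtain ⟨g, hg, hc0, hcs⟩ := hA.exists_compression hs d (hD.le hdD) hd0
  rw [hA.mul_comm (hD.le hdD) hg] at hc0 hcs
  set c := g * d
  have hc : c ∈ A := mul_mem hg (hD.le hdD)
  have norm_ne_zero : ‖star c * c‖ ≠ 0 :=
    norm_ne_zero_iff.2 ((CStarRing.star_mul_self_ne_zero_iff c).2 hc0)
  have compress_mem : star c * c * s * (star c * c) ∈ A := by
    nth_rw 2 [hA.mul_comm (star_mem hc) hc]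
    simpa only [mul_assoc] using mul_mem (mul_mem (star_mem hc) hcs) (star_mem hc)
  refine ⟨(‖star c * c‖⁻¹ : ℂ) • (star c * c),
    SMulMemClass.smul_mem _ (hD.star_mul_self_mem hdD hg), ?_, ?_, ?_⟩
  · rw [← Complex.ofReal_inv, Complex.coe_smul]
    exact smul_nonneg (by positivity) (star_mul_self_nonneg c)
  · rw [norm_smul, norm_inv, Complex.norm_real, norm_norm, inv_mul_cancel₀ norm_ne_zero]
  · rw [smul_mul_assoc, smul_mul_assoc, mul_smul_comm]
    exact SMulMemClass.smul_mem _ (SMulMemClass.smul_mem _ compress_mem)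

theorem IsMasa.isAperiodicInclusion [IsClosed (A : Set B)] (hA : IsMasa A)
    (hreg : IsRegularInclusion A) : IsAperiodicInclusion A := by
  intro ε hε D hD hD0 b
  obtain ⟨s, hs, hs_span⟩ := Metric.dense_iff.1 hreg b ε hε
  obtain ⟨a, haD, ha0, ha1, hsa⟩ := hA.exists_nonneg_compression hs_span hD hD0
  refine ⟨a, haD, ha0, ha1, (norm_mk_mul_mul_le ha1.le hsa).trans_lt ?_⟩
  rwa [← dist_eq_norm, dist_comm]

end Aperiodic

section LocalExpectation

open LocalMultiplier
open scoped CStarAlgebra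

variable {B : Type*} [NonUnitalCStarAlgebra B] [PartialOrder B] [StarOrderedRing B]
  {A : NonUnitalStarSubalgebra ℂ B} [IsClosed (A : Set B)] {E F : B →CP LocalMultiplier A}

namespace IsLocalExpectation

theorem map_coe_mul (hE : IsLocalExpectation A E) (a : A) (b : B) :
    E (a * b) = ofElem a * E b := by
  have h := hE.apply_coe (a * star a)
  rw [ofElem_mul, ofElem_star, ← hE.apply_coe] at h
  rw [map_mul_of_map_mul_star_self hE.contractive h, hE.apply_coe]

theorem map_mul_coe (hE : IsLocalExpectation A E) (b : B) (a : A) :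
    E (b * a) = E b * ofElem a := by
  have h := congrArg star (hE.map_coe_mul (star a) (star b))
  rwa [← map_star, StarMemClass.coe_star, ← star_mul, star_star, star_mul, ofElem_star, star_star,
    ← map_star, star_star] at h

theorem unique (hA : IsMasa A) (hreg : IsRegularInclusion A) (hE : IsLocalExpectation A E)
    (hF : IsLocalExpectation A F) : E = F := by
  refine DFunLike.coe_injective
    (Continuous.ext_on hreg (map_continuous E) (map_continuous F) fun s hs => ?_)
  refine sub_eq_zero.1 (eq_zero_of_compression
    (fun a b => Subtype.ext (hA.mul_comm a.2 b.2)) fun d hd0 => ?_)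
  obtain ⟨g, hg, hc0, hcs⟩ := hA.exists_compression hs d d.2 fun h => hd0 (Subtype.ext h)
  refine ⟨⟨g, hg⟩, fun h => hc0 (congrArg Subtype.val h), ?_⟩
  rw [mul_sub, sub_mul, sub_eq_zero, ← hE.map_coe_mul, ← hE.map_mul_coe, ← hF.map_coe_mul,
    ← hF.map_mul_coe]
  exact (hE.apply_coe ⟨_, hcs⟩).trans (hF.apply_coe ⟨_, hcs⟩).symm

end IsLocalExpectation

end LocalExpectation

section Slice

open LocalMultiplier
open scoped CStarAlgebra

variable {B : Type*} [NonUnitalCStarAlgebra B] {A : NonUnitalStarSubalgebra ℂ B}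
  [IsClosed (A : Set B)] {W : Submodule ℂ B}

namespace IsSlice

theorem mul_interIdeal_mem (hW : IsSlice A W) {w : B} (hw : w ∈ W) (x : hW.interIdeal) :
    w * (x : A) ∈ A := by
  simpa only [StarMemClass.coe_star, star_star] using hW.mul_star_mem w hw _ (star x).2

theorem interIdeal_mul_mem (hW : IsSlice A W) {w : B} (hw : w ∈ W) (x : hW.interIdeal) :
    ((x : A) : B) * w ∈ A := by
  simpa only [StarMemClass.coe_star, star_star] using hW.star_mul_mem _ (star x).2 w hw

/-- The multiplier of the ideal `W ∩ A` given by multiplication with an element of the slice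
`W`. -/
def multiplier (hW : IsSlice A W) {w : B} (hw : w ∈ W) : DoubleCentralizer ℂ hW.interIdeal where
  fst :=
    { toFun := fun x => ⟨⟨w * (x : A), hW.mul_interIdeal_mem hw x⟩,
        hW.mul_mem_right (x : A) (x : A).2 w hw⟩
      map_add' := fun _ _ => Subtype.ext <| Subtype.ext <| mul_add w _ _
      map_smul' := fun c _ => Subtype.ext <| Subtype.ext <| mul_smul_comm c w _
      cont := (((continuous_subtype_val.comp continuous_subtype_val).const_mul w).subtype_mk
        _).subtype_mk _ }
  snd :=
    { toFun := fun x => ⟨⟨(x : A) * w, hW.interIdeal_mul_mem hw x⟩,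
        hW.mul_mem_left (x : A) (x : A).2 w hw⟩
      map_add' := fun _ _ => Subtype.ext <| Subtype.ext <| add_mul _ _ w
      map_smul' := fun c _ => Subtype.ext <| Subtype.ext <| smul_mul_assoc c _ w
      cont := (((continuous_subtype_val.comp continuous_subtype_val).mul_const w).subtype_mk
        _).subtype_mk _ }
  central _ _ := Subtype.ext <| Subtype.ext <| mul_assoc _ _ _

theorem compression_mul_perp_eq_zero (hW : IsSlice A W) {w : B} (hw : w ∈ W) {y c : A}
    (hy : y ∈ hW.interIdeal.perp) (hc : c * (w * y) * c ∈ A) : c * (w * y) * c = 0 := by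
  let t : A := ⟨c * (w * y) * c, hc⟩
  have ht : t ∈ hW.interIdeal :=
    hW.mul_mem_right c c.2 _ (hW.mul_mem_left c c.2 _ (hW.mul_mem_right y y.2 w hw))
  have hyt : y * (c * star t) = 0 :=
    ClosedIdeal.perp_mul hy (hW.interIdeal.mul_mem_left c (star_mem ht))
  rw [← CStarRing.mul_star_self_eq_zero_iff]
  calc (c * (w * y) * c : B) * star (c * (w * y) * c : B) = c * w * (y * (c * star t) : A) := by
        simp only [t, NonUnitalStarSubalgebra.coe_mul, StarMemClass.coe_star, mul_assoc]
    _ = 0 := by rw [hyt, ZeroMemClass.coe_zero, mul_zero]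

end IsSlice

namespace IsLocalExpectation

variable [PartialOrder B] [StarOrderedRing B] {E : B →CP LocalMultiplier A}

theorem map_slice_mul_perp (hA : IsMasa A) (hE : IsLocalExpectation A E) (hW : IsSlice A W) {w : B}
    (hw : w ∈ W) {y : A} (hy : y ∈ hW.interIdeal.perp) : E (w * y) = 0 := by
  refine eq_zero_of_compression (fun a b => Subtype.ext (hA.mul_comm a.2 b.2)) fun d hd0 => ?_
  obtain ⟨g, hg, hc0, hcwy⟩ := hA.exists_compression_normaliser
    (hW.isNormaliser _ (hW.mul_mem_right y y.2 w hw)) d.2 fun h => hd0 (Subtype.ext h)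
  refine ⟨⟨g, hg⟩, fun h => hc0 (congrArg Subtype.val h), ?_⟩
  rw [← hE.map_coe_mul, ← hE.map_mul_coe, hW.compression_mul_perp_eq_zero hw hy hcwy, map_zero]

theorem map_slice (hA : IsMasa A) (hE : IsLocalExpectation A E) (hW : IsSlice A W) {w : B}
    (hw : w ∈ W) : E w = ofIdealMultiplier hW.interIdeal (hW.multiplier hw) := by
  refine sub_eq_zero.1 (eq_zero_of_mul_ofElem hW.interIdeal.sumPerp_isEssential fun z hz => ?_)
  let x := hW.interIdeal.proj ⟨z, hz⟩
  have h_perp : z - x ∈ hW.interIdeal.perp := hW.interIdeal.sub_proj_mem ⟨z, hz⟩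
  have map_mul_z : E w * ofElem z = ofElem ⟨w * (x : A), hW.mul_interIdeal_mem hw x⟩ := by
    rw [← hE.map_mul_coe, ← hE.apply_coe, ← sub_eq_zero, ← map_sub, ← mul_sub]
    exact hE.map_slice_mul_perp hA hW hw h_perp
  have multiplier_mul_z : ofIdealMultiplier hW.interIdeal (hW.multiplier hw) * ofElem z =
      ofElem ⟨w * (x : A), hW.mul_interIdeal_mem hw x⟩ :=
    ofIdealMultiplier_mul_ofElem hW.interIdeal (hW.multiplier hw) ⟨z, hz⟩
  rw [sub_mul, map_mul_z, multiplier_mul_z, sub_self]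

end IsLocalExpectation

end Slice

end

theorem mainTheorem9 {B : Type*} [NonUnitalCStarAlgebra B] [PartialOrder B] [StarOrderedRing B]
    (A : NonUnitalStarSubalgebra ℂ B) [IsClosed (A : Set B)]
    (hmasa : IsMasa A) (hreg : IsRegularInclusion A) :
    IsAperiodicInclusion A ∧
    (∀ E F : CompletelyPositiveMap B (LocalMultiplier A),
      IsLocalExpectation A E → IsLocalExpectation A F → E = F) ∧
    (∀ E : CompletelyPositiveMap B (LocalMultiplier A), IsLocalExpectation A E →
      ∀ (W : Submodule ℂ B) (hW : IsSlice A W), ∀ w ∈ W,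
        ∃ m : DoubleCentralizer ℂ hW.interIdeal,
          E w = LocalMultiplier.ofIdealMultiplier hW.interIdeal m) :=
  ⟨hmasa.isAperiodicInclusion hreg, fun _ _ hE hF => hE.unique hmasa hreg hF,
    fun _ hE _ hW _ hw => ⟨hW.multiplier hw, hE.map_slice hmasa hW hw⟩⟩
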